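/- Let $R$ be an associative ring with $1$. An idempotent $e\in R$ is called local if $\mathrm{End}_R(eR_R)$ is a local ring. Suppose that $R$ is semiperfect, i.e. $1$ is a sum of finitely many pairwise orthogonal local idempotents $E_1,\dots,E_m$. A basic set of idempotents of $R$ is a subfamily $e_1,\dots,e_n$ of such a decomposition such that each right module $E_jR$ is isomorphic to exactly one of $e_1R,\dots,e_nR$. For a module $M$, let $\mathrm{soc}(M)$ be the sum of its simple submodules and let $\mathrm{top}(M)=M/\mathrm{rad}(M)$, where $\mathrm{rad}(M)$ is the intersection of the maximal submodules of $M$. Suppose that $R$ has a Nakayama permutation, i.e. for some basic set of idempotents $e_1,\dots,e_n$ there is a permutation $\pi$ of $\{1,\dots,n\}$ such that, for every $k$, $$\mathrm{soc}(e_kR)\cong \mathrm{top}(e_{\pi(k)}R)\ \text{ as right modules, and }\ \mathrm{soc}(Re_{\pi(k)})\cong \mathrm{top}(Re_k)\ \text{ as left modules}.$$ Suppose moreover that the right socle $S_r=\mathrm{soc}(R_R)$ and the left socle $S_l=\mathrm{soc}({}_RR)$ coincide as subsets of $R$, and write $\mathrm{soc}(R)=S_r=S_l$. Let $I$ be a right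 ideal of $R$ that is semisimple as a right $R$-module. Then there exists an idempotent $f\in R$ such that $$I=\mathrm{soc}(fR)=f\,\mathrm{soc}(R).$$ -/

import Mathlib

/-! Right `R`-modules are modules over `Rᵐᵒᵖ`; a right ideal of `R` is a `Submodule Rᵐᵒᵖ R`. -/

namespace SemiperfectRing

/-- The socle of a module: the sum of its simple submodules. -/
def socle (A M : Type*) [Ring A] [AddCommGroup M] [Module A M] : Submodule A M :=
  sSup {S : Submodule A M | IsSimpleModule A S}

/-- The top `M / rad M` of a module, where `rad M` is the intersection of the maximal
submodules of `M`. -/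
abbrev Top (A M : Type*) [Ring A] [AddCommGroup M] [Module A M] : Type _ :=
  M ⧸ Module.jacobson A M

variable {R : Type*} [Ring R]

/-- The principal right ideal `e R`. -/
def rightIdeal (e : R) : Submodule Rᵐᵒᵖ R := Submodule.span Rᵐᵒᵖ {e}

/-- The principal left ideal `R e`. -/
def leftIdeal (e : R) : Submodule R R := Submodule.span R {e}

variable (R) in
/-- The right socle `S_r = soc(R_R)`. -/
def rightSocle : Submodule Rᵐᵒᵖ R := socle Rᵐᵒᵖ R

variable (R) in
/-- The left socle `S_l = soc(_R R)`. -/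
def leftSocle : Submodule R R := socle R R

/-- An idempotent `e` is local if the endomorphism ring of the right module `e R` is local. -/
structure IsLocalIdempotent (e : R) : Prop where
  idem : IsIdempotentElem e
  isLocalRing_end : IsLocalRing (Module.End Rᵐᵒᵖ (rightIdeal e))

/-- A finite family of pairwise orthogonal local idempotents with sum `1`. -/
structure IsLocalDecomposition {m : ℕ} (E : Fin m → R) : Prop where
  complete : CompleteOrthogonalIdempotents E
  isLocal : ∀ i, IsLocalIdempotent (E i)

variable (R) in
/-- `R` is semiperfect: `1` is a finite sum of pairwise orthogonal local idempotents. -/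
def IsSemiperfect : Prop := ∃ (m : ℕ) (E : Fin m → R), IsLocalDecomposition E

/-- `e₁, …, eₙ` is a basic set of idempotents: it is a subfamily of a decomposition of `1` into
pairwise orthogonal local idempotents `E₁, …, Eₘ` that contains exactly one representative of
each isomorphism class of the right modules `E₁ R, …, Eₘ R`. -/
def IsBasicSet {n : ℕ} (e : Fin n → R) : Prop :=
  ∃ (m : ℕ) (E : Fin m → R) (ι : Fin n ↪ Fin m), IsLocalDecomposition E ∧
    (∀ k, e k = E (ι k)) ∧
    ∀ j, ∃! k, Nonempty (rightIdeal (E j) ≃ₗ[Rᵐᵒᵖ] rightIdeal (e k))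

/-- `π` is a Nakayama permutation with respect to `e₁, …, eₙ`: for every `k`,
`soc(e_k R) ≅ top(e_{π k} R)` as right modules and `soc(R e_{π k}) ≅ top(R e_k)` as left
modules. -/
structure IsNakayamaPermutation {n : ℕ} (e : Fin n → R) (π : Equiv.Perm (Fin n)) : Prop where
  right : ∀ k, Nonempty
    (socle Rᵐᵒᵖ (rightIdeal (e k)) ≃ₗ[Rᵐᵒᵖ] Top Rᵐᵒᵖ (rightIdeal (e (π k))))
  left : ∀ k, Nonempty
    (socle R (leftIdeal (e (π k))) ≃ₗ[R] Top R (leftIdeal (e k)))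

variable (R) in
/-- `R` has a Nakayama permutation (with respect to some basic set of idempotents). -/
def HasNakayamaPermutation : Prop :=
  ∃ (n : ℕ) (e : Fin n → R) (π : Equiv.Perm (Fin n)),
    IsBasicSet e ∧ IsNakayamaPermutation e π

end SemiperfectRing

namespace SemiperfectRing

/-! ### Socles and tops of modules -/

section Modules

variable {A M N : Type*} [Ring A] [AddCommGroup M] [Module A M] [AddCommGroup N] [Module A N]

/-! Write S for the common socle. The Nakayama permutation makes every soc(E_i R) simple, so a
maximal set of the E_i whose sum h satisfies I ∩ hS = 0 gives S = I ⊕ hS.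

The point is that the projection of S onto hS along I is a left multiplication. Each soc(E_i R) has
a generator s = sc, where c is the basic idempotent assigned by π. As S is also the left socle, s
lies in Sc = soc(Rc), which is simple, so Rs = Sc (`exists_generator`). The projection is right
linear, hence sends s into Sc, that is, to rs for some r in R. Gluing these r along the E_i gives u,
and f = (1 - hu)(1 - h) is an idempotent with fS = I (`exists_idempotent_of_generators`). -/

theorem map_mem_socle (φ : M →ₗ[A] N) {x : M} (hx : x ∈ socle A M) : φ x ∈ socle A N := by
  suffices h : socle A M ≤ (socle A N).comap φ from h hx
  refine sSup_le fun P (hP : IsSimpleModule A P) => ?_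
  rcases LinearMap.injective_or_eq_zero (φ.domRestrict P) with h | h
  · have hsimple : IsSimpleModule A (LinearMap.range (φ.domRestrict P)) :=
      IsSimpleModule.congr (LinearEquiv.ofInjective _ h).symm
    intro y hy
    exact le_sSup (a := LinearMap.range (φ.domRestrict P)) hsimple ⟨⟨y, hy⟩, rfl⟩
  · intro y hy
    have h0 : φ y = 0 := LinearMap.congr_fun h ⟨y, hy⟩
    rw [Submodule.mem_comap, h0]
    exact zero_mem _

theorem map_socle_equiv (φ : M ≃ₗ[A] N) :
    (socle A M).map (φ : M →ₗ[A] N) = socle A N := by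
  apply le_antisymm
  · rintro _ ⟨x, hx, rfl⟩
    exact map_mem_socle (φ : M →ₗ[A] N) hx
  · intro y hy
    exact ⟨φ.symm y, map_mem_socle (φ.symm : N →ₗ[A] M) hy, φ.apply_symm_apply y⟩

/-- Isomorphic modules have isomorphic socles. -/
def socleCongr (φ : M ≃ₗ[A] N) : socle A M ≃ₗ[A] socle A N :=
  (φ.submoduleMap (socle A M)).trans (LinearEquiv.ofEq _ _ (map_socle_equiv φ))

theorem le_socle_of_isSemisimpleModule (P : Submodule A M) [IsSemisimpleModule A P] :
    P ≤ socle A M := by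
  intro x hx
  have h : (⟨x, hx⟩ : P) ∈ socle A P := by
    have := IsSemisimpleModule.sSup_simples_eq_top A P
    rw [socle, this]
    trivial
  exact map_mem_socle P.subtype h

/-- A nonzero finitely generated module in which no two proper submodules span has simple top. -/
theorem isSimpleModule_top [Nontrivial M] [Module.Finite A M]
    (h : ∀ P Q : Submodule A M, P ⊔ Q = ⊤ → P = ⊤ ∨ Q = ⊤) : IsSimpleModule A (Top A M) := by
  obtain ⟨P, hP, -⟩ := (eq_top_or_exists_le_coatom (⊥ : Submodule A M)).resolve_left bot_ne_top
  have hJ : Module.jacobson A M = P := by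
    refine le_antisymm (sInf_le hP) (le_sInf fun Q (hQ : IsCoatom Q) => ?_)
    by_contra hPQ
    rcases h P Q (hQ.2 _ (right_lt_sup.2 hPQ)) with h | h
    · exact hP.1 h
    · exact hQ.1 h
  exact isSimpleModule_iff_isCoatom.2 (hJ.symm ▸ hP)

end Modules

/-! ### Local idempotents and their one-sided ideals -/

section Idempotents

variable {R : Type*} [Ring R] {e : R}

theorem mem_rightIdeal (he : IsIdempotentElem e) {x : R} : x ∈ rightIdeal e ↔ e * x = x := by
  rw [rightIdeal, Submodule.mem_span_singleton]
  constructor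
  · rintro ⟨a, rfl⟩
    rw [mul_smul_comm, he.eq]
  · intro h
    exact ⟨MulOpposite.op x, h⟩

theorem mem_leftIdeal (he : IsIdempotentElem e) {x : R} : x ∈ leftIdeal e ↔ x * e = x := by
  rw [leftIdeal, Submodule.mem_span_singleton]
  constructor
  · rintro ⟨a, rfl⟩
    rw [smul_mul_assoc, he.eq]
  · intro h
    exact ⟨x, h⟩

/-- Left multiplication by `a` on the right module `R`. -/
def leftMul (a : R) : R →ₗ[Rᵐᵒᵖ] R := DistribSMul.toLinearMap Rᵐᵒᵖ R a

theorem leftMul_apply (a x : R) : leftMul a x = a * x := rfl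

/-- Left multiplication by `a ∈ e R` as an endomorphism of the right module `e R`. -/
def leftMulEnd (he : IsIdempotentElem e) (a : R) (ha : e * a = a) :
    Module.End Rᵐᵒᵖ (rightIdeal e) :=
  ((leftMul a).comp (rightIdeal e).subtype).codRestrict _ fun x =>
    (mem_rightIdeal he).2 (by simp [leftMul_apply, ← mul_assoc, ha])

theorem coe_leftMulEnd_apply (he : IsIdempotentElem e) (a : R) (ha : e * a = a)
    (x : rightIdeal e) : (leftMulEnd he a ha x : R) = a * x := rfl

theorem IsLocalIdempotent.ne_zero (he : IsLocalIdempotent e) : e ≠ 0 := by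
  rintro rfl
  have := he.isLocalRing_end
  refine zero_ne_one (α := Module.End Rᵐᵒᵖ (rightIdeal (0 : R))) (LinearMap.ext fun x => ?_)
  have hx := (mem_rightIdeal he.idem).1 x.2
  rw [zero_mul] at hx
  exact Subtype.ext hx

/-- An element `a` of `e R` acting invertibly on `e R` is invertible in `e R e`. -/
theorem exists_inverse_of_isUnit (he : IsIdempotentElem e) {a : R} (ha : e * a = a)
    (ha' : a * e = a) (hu : IsUnit (leftMulEnd he a ha)) : ∃ c, a * c = e ∧ c * a = e := by
  obtain ⟨ψ, hψ₁, hψ₂⟩ := isUnit_iff_exists.1 hu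
  let e' : rightIdeal e := ⟨e, (mem_rightIdeal he).2 he⟩
  refine ⟨ψ e', ?_, ?_⟩
  · exact congrArg Subtype.val (LinearMap.congr_fun hψ₁ e')
  · have h₁ : leftMulEnd he a ha e' = MulOpposite.op a • e' :=
      Subtype.ext (by simp [coe_leftMulEnd_apply, e', ha, ha'])
    have h₂ := congrArg Subtype.val (LinearMap.congr_fun hψ₂ e')
    rw [Module.End.mul_apply, h₁, map_smul] at h₂
    simpa using h₂

/-- Left multiplications by a and b are endomorphisms of eR with sum 1, so one of them is
invertible. The conclusion is left-right symmetric, so it serves Re as well as eR although locality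
is defined through eR. -/
theorem IsLocalIdempotent.exists_inverse (he : IsLocalIdempotent e) {a b : R} (ha : e * a = a)
    (ha' : a * e = a) (hb : e * b = b) (hb' : b * e = b) (hab : a + b = e) :
    (∃ c, a * c = e ∧ c * a = e) ∨ ∃ c, b * c = e ∧ c * b = e := by
  have := he.isLocalRing_end
  have hsum : leftMulEnd he.idem a ha + leftMulEnd he.idem b hb = 1 := by
    refine LinearMap.ext fun x => Subtype.ext ?_
    have hx := (mem_rightIdeal he.idem).1 x.2
    simp [coe_leftMulEnd_apply, ← add_mul, hab, hx]
  exact (IsLocalRing.isUnit_or_isUnit_of_add_one hsum).imp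
    (exists_inverse_of_isUnit he.idem ha ha') (exists_inverse_of_isUnit he.idem hb hb')

theorem IsLocalIdempotent.isSimpleModule_top_right (he : IsLocalIdempotent e) :
    IsSimpleModule Rᵐᵒᵖ (Top Rᵐᵒᵖ (rightIdeal e)) := by
  have hee := he.idem.eq
  let e' : rightIdeal e := ⟨e, (mem_rightIdeal he.idem).2 hee⟩
  have : Nontrivial (rightIdeal e) :=
    ⟨e', 0, fun h => he.ne_zero (congrArg Subtype.val h)⟩
  have : Module.Finite Rᵐᵒᵖ (rightIdeal e) := Module.Finite.span_singleton _ _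
  have key : ∀ (P : Submodule Rᵐᵒᵖ (rightIdeal e)) (a : rightIdeal e), a ∈ P →
      (∃ c, (a * e : R) * c = e ∧ c * (a * e : R) = e) → P = ⊤ := by
    rintro P a ha ⟨c, hc, -⟩
    refine eq_top_iff.2 fun x _ => ?_
    have : x = MulOpposite.op (e * c * x) • a := Subtype.ext (by
      simp only [Submodule.coe_smul, op_smul_eq_mul, ← mul_assoc]
      rw [hc, (mem_rightIdeal he.idem).1 x.2])
    rw [this]
    exact P.smul_mem _ ha
  refine isSimpleModule_top fun P Q hPQ => ?_
  obtain ⟨a, ha, b, hb, hab⟩ := Submodule.mem_sup.1 (hPQ ▸ Submodule.mem_top : e' ∈ P ⊔ Q)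
  have hab : (a + b : R) = e := congrArg Subtype.val hab
  have ha₁ := (mem_rightIdeal he.idem).1 a.2
  have hb₁ := (mem_rightIdeal he.idem).1 b.2
  exact (he.exists_inverse (a := a * e) (b := b * e) (by rw [← mul_assoc, ha₁])
    (by rw [mul_assoc, hee]) (by rw [← mul_assoc, hb₁]) (by rw [mul_assoc, hee])
    (by rw [← add_mul, hab, hee])).imp (key P a ha) (key Q b hb)

theorem IsLocalIdempotent.isSimpleModule_top_left (he : IsLocalIdempotent e) :
    IsSimpleModule R (Top R (leftIdeal e)) := by
  have hee := he.idem.eq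
  let e' : leftIdeal e := ⟨e, (mem_leftIdeal he.idem).2 hee⟩
  have : Nontrivial (leftIdeal e) :=
    ⟨e', 0, fun h => he.ne_zero (congrArg Subtype.val h)⟩
  have : Module.Finite R (leftIdeal e) := Module.Finite.span_singleton _ _
  have key : ∀ (P : Submodule R (leftIdeal e)) (a : leftIdeal e), a ∈ P →
      (∃ c, (e * a : R) * c = e ∧ c * (e * a : R) = e) → P = ⊤ := by
    rintro P a ha ⟨c, -, hc⟩
    refine eq_top_iff.2 fun x _ => ?_
    have : x = (x * c * e : R) • a := Subtype.ext (by
      simp only [Submodule.coe_smul, smul_eq_mul]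
      rw [mul_assoc, mul_assoc, hc, (mem_leftIdeal he.idem).1 x.2])
    rw [this]
    exact P.smul_mem _ ha
  refine isSimpleModule_top fun P Q hPQ => ?_
  obtain ⟨a, ha, b, hb, hab⟩ := Submodule.mem_sup.1 (hPQ ▸ Submodule.mem_top : e' ∈ P ⊔ Q)
  have hab : (a + b : R) = e := congrArg Subtype.val hab
  have ha₁ := (mem_leftIdeal he.idem).1 a.2
  have hb₁ := (mem_leftIdeal he.idem).1 b.2
  exact (he.exists_inverse (a := e * a) (b := e * b) (by rw [← mul_assoc, hee])
    (by rw [mul_assoc, ha₁]) (by rw [← mul_assoc, hee]) (by rw [mul_assoc, hb₁])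
    (by rw [← mul_add, hab, hee])).imp (key P a ha) (key Q b hb)

/-- The socle of `e R`, as a right ideal of `R`. -/
def socleRightIdeal (e : R) : Submodule Rᵐᵒᵖ R :=
  (socle Rᵐᵒᵖ (rightIdeal e)).map (rightIdeal e).subtype

theorem mem_socleRightIdeal (he : IsIdempotentElem e) {x : R} :
    x ∈ socleRightIdeal e ↔ x ∈ rightSocle R ∧ e * x = x := by
  constructor
  · rintro ⟨y, hy, rfl⟩
    exact ⟨map_mem_socle (rightIdeal e).subtype hy, (mem_rightIdeal he).1 y.2⟩
  · rintro ⟨hx, hex⟩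
    have h := map_mem_socle ((leftMul e).codRestrict (rightIdeal e) fun y =>
      (mem_rightIdeal he).2 (by rw [leftMul_apply, ← mul_assoc, he.eq])) hx
    exact ⟨_, h, hex⟩

theorem coe_socleRightIdeal (he : IsIdempotentElem e) :
    (socleRightIdeal e : Set R) = (fun s : R => e * s) '' (rightSocle R : Set R) := by
  ext x
  rw [SetLike.mem_coe, mem_socleRightIdeal he]
  constructor
  · rintro ⟨hx, hex⟩
    exact ⟨x, hx, hex⟩
  · rintro ⟨s, hs, rfl⟩
    exact ⟨map_mem_socle (leftMul e) hs, by simp only [← mul_assoc, he.eq]⟩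

theorem exists_mem_socle_leftIdeal (he : IsIdempotentElem e) {x : R} (hx : x ∈ leftSocle R)
    (hxe : x * e = x) : ∃ y ∈ socle R (leftIdeal e), (y : R) = x := by
  have h := map_mem_socle ((LinearMap.toSpanSingleton R R e).codRestrict (leftIdeal e) fun y =>
    (mem_leftIdeal he).2 (by simp [mul_assoc, he.eq])) hx
  exact ⟨_, h, hxe⟩

/-- If the socle of `E R` is isomorphic to the top of `c R` and `R c` has simple socle, then
the socle of `E R` is generated by an element that also generates the socle of `R c`. -/
theorem exists_generator {E c : R} (hE : IsIdempotentElem E) (hc : IsLocalIdempotent c)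
    (hS : (rightSocle R : Set R) = (leftSocle R : Set R))
    (θ : socle Rᵐᵒᵖ (rightIdeal E) ≃ₗ[Rᵐᵒᵖ] Top Rᵐᵒᵖ (rightIdeal c))
    (hl : IsSimpleModule R (socle R (leftIdeal c))) :
    IsSimpleModule Rᵐᵒᵖ (socleRightIdeal E) ∧
      ∃ s ∈ socleRightIdeal E, s * c = s ∧
        (∀ x ∈ socleRightIdeal E, ∃ a, x = s * a) ∧
        ∀ y ∈ rightSocle R, y * c = y → ∃ r, y = r * s := by
  have htop := hc.isSimpleModule_top_right
  have hsimple : IsSimpleModule Rᵐᵒᵖ (socleRightIdeal E) :=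
    IsSimpleModule.congr (((Submodule.equivMapOfInjective (rightIdeal E).subtype
      Subtype.val_injective _).symm).trans θ)
  refine ⟨hsimple, ?_⟩
  let c' : rightIdeal c := ⟨c, (mem_rightIdeal hc.idem).2 hc.idem⟩
  have hcc : MulOpposite.op c • c' = c' := Subtype.ext hc.idem
  -- The class of c generates the top and is fixed by right multiplication by c; its preimage under
  -- θ inherits s * c = s.
  let t : Top Rᵐᵒᵖ (rightIdeal c) := Submodule.Quotient.mk c'
  have htc : MulOpposite.op c • t = t := congrArg Submodule.Quotient.mk hcc
  have ht : t ≠ 0 := by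
    intro h0
    have := IsSimpleModule.nontrivial Rᵐᵒᵖ (Top Rᵐᵒᵖ (rightIdeal c))
    obtain ⟨q, hq⟩ := exists_ne (0 : Top Rᵐᵒᵖ (rightIdeal c))
    obtain ⟨x, rfl⟩ := Submodule.Quotient.mk_surjective _ q
    apply hq
    have hx : x = MulOpposite.op (x : R) • c' :=
      Subtype.ext ((mem_rightIdeal hc.idem).1 x.2).symm
    rw [hx, Submodule.Quotient.mk_smul]
    change _ • t = 0
    rw [h0, smul_zero]
  have hsne : θ.symm t ≠ 0 := by simpa using ht
  have hsc : MulOpposite.op c • θ.symm t = θ.symm t := by rw [← map_smul, htc]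
  set u := θ.symm t with hu
  have hmem : ((u : rightIdeal E) : R) ∈ socleRightIdeal E := ⟨u, u.2, rfl⟩
  have hsc' : ((u : rightIdeal E) : R) * c = (u : rightIdeal E) :=
    congrArg (fun z : socle Rᵐᵒᵖ (rightIdeal E) => ((z : rightIdeal E) : R)) hsc
  have hs0 : ((u : rightIdeal E) : R) ≠ 0 := fun h => hsne (Subtype.ext (Subtype.ext h))
  refine ⟨(u : rightIdeal E), hmem, hsc', fun x hx => ?_, fun y hy hyc => ?_⟩
  · obtain ⟨a, ha⟩ := IsSimpleModule.toSpanSingleton_surjective Rᵐᵒᵖ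
      (m := (⟨_, hmem⟩ : socleRightIdeal E)) (fun h => hs0 (congrArg Subtype.val h)) ⟨x, hx⟩
    exact ⟨a.unop, (congrArg Subtype.val ha).symm⟩
  -- Equality of the two socles places s and y in the simple left module soc(Rc), where the nonzero
  -- s generates.
  · have hmono : ∀ z, z ∈ rightSocle R → z ∈ leftSocle R := fun z hz => hS.subset hz
    obtain ⟨s₁, hs₁, hs₁'⟩ := exists_mem_socle_leftIdeal hc.idem
      (hmono _ ((mem_socleRightIdeal hE).1 hmem).1) hsc'
    obtain ⟨y₁, hy₁, rfl⟩ := exists_mem_socle_leftIdeal hc.idem (hmono _ hy) hyc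
    obtain ⟨r, hr⟩ := IsSimpleModule.toSpanSingleton_surjective R
      (m := (⟨s₁, hs₁⟩ : socle R (leftIdeal c)))
      (fun h => hs0 (hs₁' ▸ congrArg (fun z : socle R (leftIdeal c) => ((z : leftIdeal c) : R)) h))
      ⟨y₁, hy₁⟩
    refine ⟨r, ?_⟩
    rw [← hs₁']
    exact (congrArg (fun z : socle R (leftIdeal c) => ((z : leftIdeal c) : R)) hr).symm

end Idempotents

/-- In a modular lattice, an element can be complemented in its join with finitely many atoms by
some of these atoms. -/
theorem exists_finset_disjoint_le_sup {α ι : Type*} [Lattice α] [OrderBot α] [IsModularLattice α]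
    [Fintype ι] [DecidableEq ι] (K : ι → α) (hK : ∀ i, IsAtom (K i)) (a : α) :
    ∃ T : Finset ι, Disjoint a (T.sup K) ∧ ∀ i, K i ≤ a ⊔ T.sup K := by
  -- T is maximal among the index sets whose join is disjoint from a; an atom not below a ⊔ T.sup K
  -- could be added to T by modularity.
  obtain ⟨T, hT⟩ := Set.Finite.exists_maximal
    (Set.toFinite {T : Finset ι | Disjoint a (T.sup K)}) ⟨∅, by simp⟩
  refine ⟨T, hT.1, fun i => ?_⟩
  by_contra hi
  have hd : Disjoint (a ⊔ T.sup K) (K i) := ((hK i).not_le_iff_disjoint.1 hi).symm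
  have hd' : Disjoint a ((insert i T).sup K) := by
    rw [Finset.sup_insert, sup_comm]
    exact Disjoint.disjoint_sup_right_of_disjoint_sup_left hT.1 hd
  have hiT : i ∈ T := hT.2 hd' (Finset.subset_insert i T) (Finset.mem_insert_self i T)
  exact hi ((Finset.le_sup hiT).trans le_sup_right)

/-! ### Realising a complement of I by an idempotent -/

section Exchange

variable {R : Type*} [Ring R]

theorem mem_finset_sup_socleRightIdeal {m : ℕ} {E : Fin m → R} (hE : OrthogonalIdempotents E)
    (T : Finset (Fin m)) {x : R} :
    x ∈ T.sup (fun i => socleRightIdeal (E i)) ↔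
      x ∈ rightSocle R ∧ (∑ i ∈ T, E i) * x = x := by
  constructor
  · let P : Submodule Rᵐᵒᵖ R :=
      rightSocle R ⊓ LinearMap.eqLocus (leftMul (∑ i ∈ T, E i)) LinearMap.id
    have h : T.sup (fun i => socleRightIdeal (E i)) ≤ P := by
      refine Finset.sup_le fun i hi y hy => ?_
      obtain ⟨hy, hy'⟩ := (mem_socleRightIdeal (hE.idem i)).1 hy
      refine ⟨hy, ?_⟩
      change (∑ i ∈ T, E i) * y = y
      rw [← hy', ← mul_assoc]
      congr 1
      simp [Finset.sum_mul, hE.mul_eq, hi]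
    exact fun hx => h hx
  · rintro ⟨hx, hx'⟩
    rw [← hx', Finset.sum_mul]
    refine Submodule.sum_mem _ fun i hi => ?_
    exact Finset.le_sup (f := fun i => socleRightIdeal (E i)) hi
      ((mem_socleRightIdeal (hE.idem i)).2
        ⟨map_mem_socle (leftMul (E i)) hx, by rw [← mul_assoc, (hE.idem i).eq]⟩)

theorem exists_idempotent_of_generators {m : ℕ} {E : Fin m → R}
    (hE : CompleteOrthogonalIdempotents E)
    (hsimple : ∀ i, IsSimpleModule Rᵐᵒᵖ (socleRightIdeal (E i)))
    (hgen : ∀ i, ∃ c, IsIdempotentElem c ∧ ∃ s ∈ socleRightIdeal (E i), s * c = s ∧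
      (∀ x ∈ socleRightIdeal (E i), ∃ a, x = s * a) ∧
      ∀ y ∈ rightSocle R, y * c = y → ∃ r, y = r * s)
    (I : Submodule Rᵐᵒᵖ R) (hI : I ≤ rightSocle R) :
    ∃ f : R, IsIdempotentElem f ∧ I = socleRightIdeal f := by
  have hO := hE.toOrthogonalIdempotents
  obtain ⟨T, hT, hle⟩ := exists_finset_disjoint_le_sup (fun i => socleRightIdeal (E i))
    (fun i => isSimpleModule_iff_isAtom.1 (hsimple i)) I
  set KT := T.sup (fun i => socleRightIdeal (E i)) with hKT
  have hKTmem : ∀ {x}, x ∈ KT ↔ x ∈ rightSocle R ∧ (∑ i ∈ T, E i) * x = x :=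
    mem_finset_sup_socleRightIdeal hO T
  have hlift : ∀ i, ∃ s r, s ∈ socleRightIdeal (E i) ∧
      (∀ x ∈ socleRightIdeal (E i), ∃ a, x = s * a) ∧ r * s ∈ KT ∧ s - r * s ∈ I := by
    intro i
    obtain ⟨c, hc, s, hs, hsc, hgs, hls⟩ := hgen i
    obtain ⟨y, hy, z, hz, hyz⟩ := Submodule.mem_sup.1 (hle i hs)
    -- Right multiplication by c fixes s and preserves both summands, so the component in `KT` may
    -- be taken in Sc = Rs.
    have hy' : y * c ∈ I := I.smul_mem (MulOpposite.op c) hy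
    have hz' : z * c ∈ KT := KT.smul_mem (MulOpposite.op c) hz
    have hyz' : y * c + z * c = s := by rw [← add_mul, hyz, hsc]
    obtain ⟨r, hr⟩ := hls (z * c) (hKTmem.1 hz').1 (by rw [mul_assoc, hc.eq])
    refine ⟨s, r, hs, hgs, hr ▸ hz', ?_⟩
    rw [← hr, ← hyz', add_sub_cancel_right]
    exact hy'
  choose s r hs hgs hrK hrI using hlift
  set h := ∑ i ∈ T, E i with hh
  have hhh : h * h = h := hO.isIdempotentElem_sum.eq
  -- Since s i = E i * s i, orthogonality makes u act on each s i as r i does.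
  set u := ∑ i, r i * E i with hu
  have hEs : ∀ i, E i * s i = s i := fun i => ((mem_socleRightIdeal (hO.idem i)).1 (hs i)).2
  have hus : ∀ i, u * s i = r i * s i := by
    intro i
    have : u * E i = r i * E i := by simp [hu, Finset.sum_mul, mul_assoc, hO.mul_eq]
    rw [← hEs i, ← mul_assoc, this, mul_assoc, hEs]
  have hff : ((1 - h) - h * u * (1 - h)) * ((1 - h) - h * u * (1 - h)) =
      (1 - h) - h * u * (1 - h) := by
    have h₁ : (1 - h) * (1 - h) = 1 - h := by
      rw [mul_sub, sub_mul, sub_mul, hhh]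
      simp
    have h₂ : (1 - h) * h = 0 := by rw [sub_mul, hhh, one_mul, sub_self]
    calc ((1 - h) - h * u * (1 - h)) * ((1 - h) - h * u * (1 - h))
        = (1 - h) * (1 - h) - (1 - h) * h * u * (1 - h) - h * u * ((1 - h) * (1 - h))
          + h * u * ((1 - h) * h) * u * (1 - h) := by noncomm_ring
      _ = _ := by rw [h₁, h₂]; simp
  -- The right factor 1 - h kills s i for i ∈ T and fixes the other s i, which f then sends to their
  -- components in I.
  set f := (1 - h) - h * u * (1 - h) with hf
  have hfs : ∀ i, f * s i ∈ I := by
    intro i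
    by_cases hi : i ∈ T
    · have h₁ : h * s i = s i := by
        rw [← hEs i, ← mul_assoc]
        congr 1
        simp [hh, Finset.sum_mul, hO.mul_eq, hi]
      have : f * s i = 0 := by
        rw [hf, sub_mul, mul_assoc (h * u), sub_mul, h₁]
        simp
      rw [this]
      exact zero_mem _
    · have h₁ : h * s i = 0 := by
        have : h * E i = 0 := by simp [hh, Finset.sum_mul, hO.mul_eq, hi]
        rw [← hEs i, ← mul_assoc, this, zero_mul]
      have : f * s i = s i - r i * s i := by
        rw [hf, sub_mul, mul_assoc (h * u), sub_mul, h₁, one_mul, sub_zero, mul_assoc, hus,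
          (hKTmem.1 (hrK i)).2]
      rw [this]
      exact hrI i
  have hfS : ∀ x ∈ rightSocle R, f * x ∈ I := by
    intro x hx
    have hx' : f * x = ∑ i, f * (E i * x) := by
      rw [← Finset.mul_sum, ← Finset.sum_mul, hE.complete, one_mul]
    rw [hx']
    refine Submodule.sum_mem _ fun i _ => ?_
    obtain ⟨a, ha⟩ := hgs i (E i * x) ((mem_socleRightIdeal (hO.idem i)).2
      ⟨map_mem_socle (leftMul (E i)) hx, by rw [← mul_assoc, (hO.idem i).eq]⟩)
    rw [ha, ← mul_assoc]
    exact I.smul_mem (MulOpposite.op a) (hfs i)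
  refine ⟨f, hff, le_antisymm (fun x hx => ?_) fun x hx => ?_⟩
  · refine (mem_socleRightIdeal hff).2 ⟨hI hx, ?_⟩
    -- 1 - f has image in hR, so x - f * x lies in I ∩ hS = 0.
    have h₁ : x - f * x ∈ I := I.sub_mem hx (hfS x (hI hx))
    have h₂ : h * (x - f * x) = x - f * x := by
      have : x - f * x = h * (x + u * ((1 - h) * x)) := by
        rw [hf]
        noncomm_ring
      rw [this, ← mul_assoc, hhh]
    exact (sub_eq_zero.1 (Submodule.disjoint_def.1 hT _ h₁ (hKTmem.2 ⟨hI h₁, h₂⟩))).symm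
  · obtain ⟨hx, hfx⟩ := (mem_socleRightIdeal hff).1 hx
    exact hfx ▸ hfS x hx

end Exchange

end SemiperfectRing

theorem mainTheorem10 {R : Type*} [Ring R]
    (hR : SemiperfectRing.IsSemiperfect R)
    (hN : SemiperfectRing.HasNakayamaPermutation R)
    (hS : (SemiperfectRing.rightSocle R : Set R) = (SemiperfectRing.leftSocle R : Set R))
    (I : Submodule Rᵐᵒᵖ R) (hI : IsSemisimpleModule Rᵐᵒᵖ I) :
    ∃ f : R, IsIdempotentElem f ∧
      I = (SemiperfectRing.socle Rᵐᵒᵖ (SemiperfectRing.rightIdeal f)).map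
        (SemiperfectRing.rightIdeal f).subtype ∧
      (I : Set R) = (fun s : R => f * s) '' (SemiperfectRing.rightSocle R : Set R) := by
  obtain ⟨n, e, π, ⟨m, E, ι, hE, he, hiso⟩, hπ⟩ := hN
  have hlocal : ∀ k, SemiperfectRing.IsLocalIdempotent (e k) := fun k => by
    rw [he k]
    exact hE.isLocal _
  have hgen : ∀ i, ∃ c, IsIdempotentElem c ∧
      IsSimpleModule Rᵐᵒᵖ (SemiperfectRing.socleRightIdeal (E i)) ∧
      ∃ s ∈ SemiperfectRing.socleRightIdeal (E i), s * c = s ∧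
        (∀ x ∈ SemiperfectRing.socleRightIdeal (E i), ∃ a, x = s * a) ∧
        ∀ y ∈ SemiperfectRing.rightSocle R, y * c = y → ∃ r, y = r * s := by
    intro i
    -- The Nakayama data concern only the basic e k; the isomorphism of E i R with e k R carries the
    -- socle condition to every E i.
    obtain ⟨k, ⟨φ⟩, -⟩ := hiso i
    obtain ⟨θ⟩ := hπ.right k
    obtain ⟨ψ⟩ := hπ.left k
    have hsimple := (hlocal k).isSimpleModule_top_left
    exact ⟨e (π k), (hlocal (π k)).idem, SemiperfectRing.exists_generator (hE.isLocal i).idem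
      (hlocal (π k)) hS ((SemiperfectRing.socleCongr φ).trans θ) (IsSimpleModule.congr ψ)⟩
  obtain ⟨f, hf, hIf⟩ := SemiperfectRing.exists_idempotent_of_generators hE.complete
    (fun i => (hgen i).elim fun _ hc => hc.2.1)
    (fun i => (hgen i).imp fun _ hc => ⟨hc.1, hc.2.2⟩) I
    (SemiperfectRing.le_socle_of_isSemisimpleModule I)
  refine ⟨f, hf, hIf, ?_⟩
  rw [hIf]
  exact SemiperfectRing.coe_socleRightIdeal hf
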